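/- Consider the hexagonal packing of the plane by circles of radius $2$ with centres $(4i+2j+2,\,2\sqrt3\,j)$, $i,j\in\mathbb{Z}$, so that the origin is the point of tangency of two horizontally aligned circles. On the circle with centre $c$, write $c(\theta)=c+2(\cos\theta,\sin\theta)$ and consider the following six types of arcs, traversed from left to right: $U$ from $c(180^\circ)$ to $c(120^\circ)$, $F$ from $c(120^\circ)$ to $c(60^\circ)$, $D$ from $c(60^\circ)$ to $c(0^\circ)$, $\overline U$ from $c(300^\circ)$ to $c(360^\circ)$, $\overline F$ from $c(240^\circ)$ to $c(300^\circ)$, and $\overline D$ from $c(180^\circ)$ to $c(240^\circ)$. A packing path is a (possibly empty) concatenation of such arcs of circles of the packing, each arc beginning where the preceding one ends, that starts at the origin, ends on the $x$-axis, and stays in the quarter plane $\{x\ge 0,\ y\ge 0\}$. Its width is the sum of the widths of its arcs, where $U,D,\overline U,\overline D$ have width $1$ and $F,\overline F$ have width $2$; equivalently, it is the abscissa of its endpoint. Let $S(x,0)=\sum_{n\ge 0}s_n x^n$, where $s_n$ is the number of packing paths of width $n$. Then, as formal power series, $$S(x,0)=\frac{x^2+r}{2x^2}=\frac{1-x^{4}-\sqrt{1-10x^{4}+9x^{8}}}{4x^{4}},\qquad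 r=\frac{1-3x^4-\sqrt{1-10x^4+9x^8}}{2x^2},$$ where the square root is the one with constant term $1$. Moreover $s_0=1$, $$s_{4n}=\frac{2}{n}\sum_{k=0}^{n}4^k\binom{n}{k}\binom{n}{k+1}\qquad (n\ge 1),$$ and $s_m=0$ for every $m$ not divisible by $4$. Finally, as $n\to\infty$, $$s_{4n}\sim\frac{3^{2n+1}}{\sqrt{\pi}\,(2n+1)^{3/2}}.$$ -/

import Mathlib

noncomputable section

namespace HexPacking

/-- The plane is `ℂ`. All circles of the packing have radius `2`; the rows of circles are at
the ordinates `2√3 j`, consecutive circles in a row have centres at distance `4`, and consecutive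
rows are shifted by `2`. The origin is the point of tangency of the two horizontally aligned
circles with centres `-2` and `2`. -/
def centres : Set ℂ :=
  {c | ∃ i j : ℤ, c = ⟨4 * (i : ℝ) + 2 * (j : ℝ) + 2, 2 * √3 * (j : ℝ)⟩}

/-- The six types of arcs: North-East, East and South-East, each in a convex version
(`U`, `F`, `D`) and a concave version (`Ubar`, `Fbar`, `Dbar`). -/
inductive Step : Type
  | U | F | D | Ubar | Fbar | Dbar

/-- The angular position, on its circle, of the left end of an arc. -/
def Step.startAngle : Step → ℝ
  | .U => Real.pi
  | .F => 2 * Real.pi / 3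
  | .D => Real.pi / 3
  | .Ubar => 5 * Real.pi / 3
  | .Fbar => 4 * Real.pi / 3
  | .Dbar => Real.pi

/-- The angular position, on its circle, of the right end of an arc. -/
def Step.endAngle : Step → ℝ
  | .U => 2 * Real.pi / 3
  | .F => Real.pi / 3
  | .D => 0
  | .Ubar => 2 * Real.pi
  | .Fbar => 5 * Real.pi / 3
  | .Dbar => 4 * Real.pi / 3

/-- The arc of type `s` on the circle with centre `c`, as a set of points of the plane. -/
def arc (c : ℂ) (s : Step) : Set ℂ :=
  circleMap c 2 '' Set.uIcc s.startAngle s.endAngle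

/-- The closed quarter plane. -/
def quarterPlane : Set ℂ := {z | 0 ≤ z.re ∧ 0 ≤ z.im}

/-- `IsPath p w q`: starting at the point `p`, arcs of circles of the packing whose types are,
in this order, the letters of `w` can be concatenated, all of them inside the quarter plane, and
the last one ends at `q`. (The circle carrying an arc is determined by the start of the arc and
its type, so that a path with a given start is the same thing as its word `w`.) -/
def IsPath : ℂ → List Step → ℂ → Prop
  | p, [], q => p = q
  | p, s :: w, q => ∃ c ∈ centres, circleMap c 2 s.startAngle = p ∧ arc c s ⊆ quarterPlane ∧
      IsPath (circleMap c 2 s.endAngle) w q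

/-- A packing path: a path starting at the origin and ending on the `x`-axis. -/
def IsPackingPath (w : List Step) : Prop := ∃ q : ℂ, IsPath 0 w q ∧ q.im = 0

/-- The horizontal displacement of an arc. -/
def Step.width : Step → ℕ
  | .U => 1
  | .F => 2
  | .D => 1
  | .Ubar => 1
  | .Fbar => 2
  | .Dbar => 1

/-- The width of a path: the horizontal displacement accumulated along it. -/
def width (w : List Step) : ℕ := (w.map Step.width).sum

/-- The set of packing paths of width `n`. -/
def packingPaths (n : ℕ) : Set (List Step) := {w | IsPackingPath w ∧ width w = n}

/-- There are finitely many packing paths of a given width. -/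
theorem packingPaths_finite (n : ℕ) : (packingPaths n).Finite := by
  have hS : Finite Step := by
    refine Set.finite_univ_iff.mp (Set.Finite.subset
      (s := {Step.U, Step.F, Step.D, Step.Ubar, Step.Fbar, Step.Dbar}) (Set.toFinite _) ?_)
    intro s _
    cases s <;> simp
  refine (List.finite_length_le Step n).subset ?_
  rintro w ⟨-, rfl⟩
  change w.length ≤ width w
  induction w with
  | nil => simp
  | cons s w ih =>
    have h1 : 1 ≤ s.width := by cases s <;> simp [Step.width]
    simp only [width, List.map_cons, List.sum_cons, List.length_cons] at ih ⊢
    omega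

/-- The abscissa of the endpoint of a path grows by the width of the path. -/
theorem IsPath.re_eq {w : List Step} : ∀ {p q : ℂ}, IsPath p w q → q.re = p.re + width w := by
  induction w with
  | nil => rintro p q rfl; simp [width]
  | cons s w ih =>
    rintro p q ⟨c, -, rfl, -, h⟩
    have h1 : Real.cos (2 * Real.pi / 3) = -(1 / 2) := by
      rw [show 2 * Real.pi / 3 = Real.pi - Real.pi / 3 by ring, Real.cos_pi_sub,
        Real.cos_pi_div_three]
    have h2 : Real.cos (4 * Real.pi / 3) = -(1 / 2) := by
      rw [show 4 * Real.pi / 3 = Real.pi / 3 + Real.pi by ring, Real.cos_add_pi,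
        Real.cos_pi_div_three]
    have h3 : Real.cos (5 * Real.pi / 3) = 1 / 2 := by
      rw [show 5 * Real.pi / 3 = 2 * Real.pi - Real.pi / 3 by ring, Real.cos_two_pi_sub,
        Real.cos_pi_div_three]
    have hre : ∀ θ : ℝ, (circleMap c 2 θ).re = c.re + 2 * Real.cos θ := by
      intro θ
      simp [circleMap, Complex.exp_ofReal_mul_I_re]
    have hs : (2 : ℝ) * Real.cos s.endAngle = 2 * Real.cos s.startAngle + s.width := by
      cases s <;> simp [Step.startAngle, Step.endAngle, Step.width, h1, h2, h3] <;> norm_num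
    have hw : (width (s :: w) : ℝ) = s.width + width w := by simp [width]
    rw [ih h, hre, hre, hw]
    linarith

/-- The generating function of the packing paths with respect to the width: the coefficient of
`x ^ n` is the number of packing paths of width `n`. -/
def widthGF : PowerSeries ℚ := PowerSeries.mk fun n => ((packingPaths n).ncard : ℚ)

end HexPacking

end

/-!
A path is determined by its word, and which arcs may follow depends only on the kind of tangency
point reached and on its height: in the basis `(1, √3 i)` all arcs have integral ends, points at
even height are horizontal tangencies (`A`), and those at odd height are of one of two slanted kinds
(`B` and `C`). An arc leaves the quarter plane only if one of its ends does, since the only arcs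
dipping below their ends occur at odd heights. Packing paths are thus the words accepted by an
explicit automaton with infinitely many states (`isPackingPath_iff_accepts`).

The generating functions of the words accepted from each state satisfy a linear system
(`isSolution_gf_accepts`) in which every step carries a positive power of `X`, so that its solution
is unique (`IsSolution.unique`). Instead of decomposing paths, one exhibits a solution which is
geometric in the height (`widthGF_eq_of_quadratic`): with `r` a root of
`x² r² - (1 - 3 x⁴) r + x² = 0`, the series at height `2k` is `S r ^ k`, and the equation at height
`0` forces `S = (x² + r) / (2 x²)`. The discriminant has the square root
`R = √(1 - z) √(1 - 9 z)`, `z = x⁴`, whose factors are written with the Catalan series.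

For the coefficients, the derivative of `R² = 1 - 10 z + 9 z²` yields a first order linear
recurrence for the coefficients of `1 / R` and of `z S'(z)`. The sums `∑ 4 ^ k C(n, k) ^ 2` and
`2 ∑ 4 ^ k C(n, k) C(n, k + 1)` obey the same recurrence by Pascal's rule
and absorption (`diagSum_succ`, `adjSum_succ`, `coeff_quarterWidthGF_and_inv`).

For the asymptotics, the product formula for `R` writes the coefficients as a convolution of the
coefficients of `√(1 - z)` with Catalan numbers multiplied by `(9 / 4) ^ j`. After division
by `9 ^ n` the first factor decays geometrically, so Tannery's theorem gives the limit as the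
product of the value of `√(1 - z)` at `1 / 9` and the Catalan asymptotics, which follow from
Wallis' product (`tendsto_convolution`, `tendsto_scaledCatalan_mul_growth`).
-/

noncomputable section

namespace HexPacking

/-! ### The automaton of heights -/

/-- The combinatorial position of a point of tangency visited by a path. `A k` is a horizontal
tangency at height `2k√3`; at height `(2k+1)√3`, `B k` is a tangency at angle `120°` of the circle
to its lower right and `C k` a tangency at angle `60°` of the circle to its lower left. -/
inductive State : Type
  | A (k : ℕ) | B (k : ℕ) | C (k : ℕ)

/-- The state reached from a state by an arc; `none` if no arc of this type starts there and stays
in the quarter plane. -/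
def State.next : State → Step → Option State
  | .A k, .U => some (.B k)
  | .A (k + 1), .Dbar => some (.C k)
  | .B k, .F => some (.C k)
  | .B k, .Ubar => some (.A (k + 1))
  | .C k, .D => some (.A k)
  | .C k, .Fbar => some (.B k)
  | _, _ => none

/-- The words leading from a given state to the `x`-axis. -/
def Accepts : State → List Step → Prop
  | st, [] => st = .A 0
  | st, s :: w => ∃ st', st.next s = some st' ∧ Accepts st' w

/-- `IsAt st x y`: the point `x + y√3 i` of the right half plane is a point of tangency in
state `st`. -/
def IsAt : State → ℤ → ℤ → Prop
  | .A k, x, y => 0 ≤ x ∧ y = 2 * k ∧ 4 ∣ x - y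
  | .B k, x, y => 0 ≤ x ∧ y = 2 * k + 1 ∧ 4 ∣ x - y
  | .C k, x, y => 0 ≤ x ∧ y = 2 * k + 1 ∧ 4 ∣ x - y - 2

/-! ### Geometry of the arcs -/

lemma circleMap_two_eq (c : ℂ) (θ : ℝ) :
    circleMap c 2 θ = ⟨c.re + 2 * Real.cos θ, c.im + 2 * Real.sin θ⟩ := by
  apply Complex.ext <;> simp [circleMap, Complex.exp_ofReal_mul_I_re, Complex.exp_ofReal_mul_I_im]

/-- The vector from the centre of its circle to the left end of an arc, in the
basis `(1, √3 i)`. -/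
def Step.startVec : Step → ℤ × ℤ
  | .U => (-2, 0)
  | .F => (-1, 1)
  | .D => (1, 1)
  | .Ubar => (1, -1)
  | .Fbar => (-1, -1)
  | .Dbar => (-2, 0)

/-- The vector from the centre of its circle to the right end of an arc, in the
basis `(1, √3 i)`. -/
def Step.endVec : Step → ℤ × ℤ
  | .U => (-1, 1)
  | .F => (1, 1)
  | .D => (2, 0)
  | .Ubar => (2, 0)
  | .Fbar => (1, -1)
  | .Dbar => (-1, -1)

lemma cos_two_pi_div_three : Real.cos (2 * Real.pi / 3) = -(1 / 2) := by
  rw [show 2 * Real.pi / 3 = Real.pi - Real.pi / 3 by ring, Real.cos_pi_sub,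
    Real.cos_pi_div_three]

lemma sin_two_pi_div_three : Real.sin (2 * Real.pi / 3) = √3 / 2 := by
  rw [show 2 * Real.pi / 3 = Real.pi - Real.pi / 3 by ring, Real.sin_pi_sub,
    Real.sin_pi_div_three]

lemma cos_four_pi_div_three : Real.cos (4 * Real.pi / 3) = -(1 / 2) := by
  rw [show 4 * Real.pi / 3 = Real.pi / 3 + Real.pi by ring, Real.cos_add_pi,
    Real.cos_pi_div_three]

lemma sin_four_pi_div_three : Real.sin (4 * Real.pi / 3) = -(√3 / 2) := by
  rw [show 4 * Real.pi / 3 = Real.pi / 3 + Real.pi by ring, Real.sin_add_pi,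
    Real.sin_pi_div_three]

lemma cos_five_pi_div_three : Real.cos (5 * Real.pi / 3) = 1 / 2 := by
  rw [show 5 * Real.pi / 3 = 2 * Real.pi - Real.pi / 3 by ring, Real.cos_two_pi_sub,
    Real.cos_pi_div_three]

lemma sin_five_pi_div_three : Real.sin (5 * Real.pi / 3) = -(√3 / 2) := by
  rw [show 5 * Real.pi / 3 = 2 * Real.pi - Real.pi / 3 by ring, Real.sin_two_pi_sub,
    Real.sin_pi_div_three]

lemma circleMap_startAngle (c : ℂ) (s : Step) : circleMap c 2 s.startAngle =
    ⟨c.re + s.startVec.1, c.im + s.startVec.2 * √3⟩ := by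
  rw [circleMap_two_eq]
  cases s <;> simp [Step.startAngle, Step.startVec, cos_two_pi_div_three, sin_two_pi_div_three,
    cos_four_pi_div_three, sin_four_pi_div_three, cos_five_pi_div_three, sin_five_pi_div_three]
    <;> ring_nf

lemma circleMap_endAngle (c : ℂ) (s : Step) : circleMap c 2 s.endAngle =
    ⟨c.re + s.endVec.1, c.im + s.endVec.2 * √3⟩ := by
  rw [circleMap_two_eq]
  cases s <;> simp [Step.endAngle, Step.endVec, cos_two_pi_div_three, sin_two_pi_div_three,
    cos_four_pi_div_three, sin_four_pi_div_three, cos_five_pi_div_three, sin_five_pi_div_three]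
    <;> ring_nf

/-- Centres in the basis `(1, √3 i)`: the second coordinate is even and congruent to the
first one minus `2` modulo `4`. -/
lemma mk_mem_centres_iff (x y : ℤ) :
    (⟨(x : ℝ), (y : ℝ) * √3⟩ : ℂ) ∈ centres ↔ 2 ∣ y ∧ 4 ∣ x - y - 2 := by
  have h3 : √3 ≠ 0 := by positivity
  constructor
  · rintro ⟨i, j, h⟩
    have hx := congrArg Complex.re h
    have hy := congrArg Complex.im h
    simp only at hx hy
    have hy' : (y : ℝ) = 2 * j := mul_right_cancel₀ h3 (by linarith)
    norm_cast at hx hy'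
    omega
  · rintro ⟨⟨j, rfl⟩, i, hi⟩
    refine ⟨i, j, ?_⟩
    have hx : (x : ℝ) = 4 * i + 2 * j + 2 := by
      have : x = 4 * i + 2 * j + 2 := by omega
      exact_mod_cast this
    rw [hx]
    congr 1
    push_cast
    ring

/-- A lower bound, in units of `√3`, for the height of an arc relative to its centre. It is attained
except for `Fbar`, whose lowest point is at relative height `-2`. -/
def Step.lower : Step → ℤ
  | .U => 0
  | .F => 1
  | .D => 0
  | .Ubar => -1
  | .Fbar => -2
  | .Dbar => -1

/-- The inequalities delimiting the three sixths of the upper half circle. -/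
lemma upper_arc_bounds {φ : ℝ} (h0 : 0 ≤ φ) (hπ : φ ≤ Real.pi) :
    0 ≤ Real.sin φ ∧ (φ ≤ 2 * Real.pi / 3 → -(1 / 2) ≤ Real.cos φ) ∧
      (2 * Real.pi / 3 ≤ φ → Real.cos φ ≤ -(1 / 2)) ∧
      (φ ≤ Real.pi / 3 → 1 / 2 ≤ Real.cos φ) ∧ (Real.pi / 3 ≤ φ → Real.cos φ ≤ 1 / 2) := by
  have hpi := Real.pi_pos
  refine ⟨Real.sin_nonneg_of_nonneg_of_le_pi h0 hπ, fun h => ?_, fun h => ?_, fun h => ?_,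
    fun h => ?_⟩
  · rw [← cos_two_pi_div_three]
    exact Real.cos_le_cos_of_nonneg_of_le_pi h0 (by linarith) h
  · rw [← cos_two_pi_div_three]
    exact Real.cos_le_cos_of_nonneg_of_le_pi (by linarith) hπ h
  · rw [← Real.cos_pi_div_three]
    exact Real.cos_le_cos_of_nonneg_of_le_pi h0 (by linarith) h
  · rw [← Real.cos_pi_div_three]
    exact Real.cos_le_cos_of_nonneg_of_le_pi (by linarith) hπ h

lemma arc_bounds {c z : ℂ} {s : Step} (hz : z ∈ arc c s) :
    c.re + s.startVec.1 ≤ z.re ∧ c.im + s.lower * √3 ≤ z.im := by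
  obtain ⟨θ, hθ, rfl⟩ := hz
  rw [circleMap_two_eq]
  have hpi := Real.pi_pos
  have hsq := Real.sin_sq_add_cos_sq θ
  have h3 : √3 ^ 2 = 3 := Real.sq_sqrt (by norm_num)
  have h3' : 1 ≤ √3 := Real.one_le_sqrt.mpr (by norm_num)
  have hm := Real.neg_one_le_cos θ
  rw [Set.mem_uIcc] at hθ
  cases s <;> simp only [Step.startAngle, Step.endAngle, Step.startVec, Step.lower] at hθ ⊢ <;>
    push_cast
  · obtain ⟨hs, -⟩ := upper_arc_bounds (φ := θ) (by grind) (by grind)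
    constructor <;> linarith
  · obtain ⟨hs, h1, -, -, h2⟩ := upper_arc_bounds (φ := θ) (by grind) (by grind)
    have h1 := h1 (by grind)
    have h2 := h2 (by grind)
    have : √3 / 2 ≤ Real.sin θ := abs_le_of_sq_le_sq' (by nlinarith) hs |>.2
    constructor <;> linarith
  · obtain ⟨hs, -, -, h1, -⟩ := upper_arc_bounds (φ := θ) (by grind) (by grind)
    have h1 := h1 (by grind)
    constructor <;> linarith
  -- The concave arcs are mirror images of the convex ones.
  all_goals
    obtain ⟨φ, rfl⟩ : ∃ φ, θ = 2 * Real.pi - φ := ⟨2 * Real.pi - θ, by ring⟩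
    rw [Real.cos_two_pi_sub, Real.sin_two_pi_sub] at *
  · obtain ⟨hs, -, -, h1, -⟩ := upper_arc_bounds (φ := φ) (by grind) (by grind)
    have h1 := h1 (by grind)
    have : Real.sin φ ≤ √3 / 2 := abs_le_of_sq_le_sq' (by nlinarith) (by positivity) |>.2
    constructor <;> linarith
  · obtain ⟨hs, h1, -⟩ := upper_arc_bounds (φ := φ) (by grind) (by grind)
    have h1 := h1 (by grind)
    have := Real.sin_le_one φ
    constructor <;> linarith
  · obtain ⟨hs, -, h1, -⟩ := upper_arc_bounds (φ := φ) (by grind) (by grind)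
    have h1 := h1 (by grind)
    have : Real.sin φ ≤ √3 / 2 := abs_le_of_sq_le_sq' (by nlinarith) (by positivity) |>.2
    constructor <;> linarith

/-! ### Packing paths as accepted words -/

/-- The circle of the packing carrying an arc with a given left end, in the
basis `(1, √3 i)`. -/
lemma circleMap_startAngle_eq_iff (c : ℂ) (s : Step) (x y : ℤ) :
    circleMap c 2 s.startAngle = ⟨(x : ℝ), (y : ℝ) * √3⟩ ↔
      c = ⟨((x - s.startVec.1 : ℤ) : ℝ), ((y - s.startVec.2 : ℤ) : ℝ) * √3⟩ := by
  rw [circleMap_startAngle]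
  simp only [Complex.ext_iff]
  push_cast
  constructor <;> rintro ⟨h1, h2⟩ <;> constructor <;> linarith

/-- One step of a path, in integer coordinates. The arc stays in the quarter plane as soon as both
its ends do: the arc `Fbar`, which dips below its ends, is only available at odd heights. -/
lemma isPath_cons_iff {s : Step} {w : List Step} {q : ℂ} {x y : ℤ} (hx : 0 ≤ x)
    (hy : 0 ≤ y) :
    IsPath ⟨(x : ℝ), (y : ℝ) * √3⟩ (s :: w) q ↔
      2 ∣ y - s.startVec.2 ∧ 4 ∣ (x - s.startVec.1) - (y - s.startVec.2) - 2 ∧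
      0 ≤ y - s.startVec.2 + s.endVec.2 ∧
      IsPath ⟨((x - s.startVec.1 + s.endVec.1 : ℤ) : ℝ),
        ((y - s.startVec.2 + s.endVec.2 : ℤ) : ℝ) * √3⟩ w q := by
  have h3 : 0 < √3 := by positivity
  have key : ∀ c : ℂ, c = ⟨((x - s.startVec.1 : ℤ) : ℝ), ((y - s.startVec.2 : ℤ) : ℝ) * √3⟩ →
      circleMap c 2 s.endAngle = ⟨((x - s.startVec.1 + s.endVec.1 : ℤ) : ℝ),
        ((y - s.startVec.2 + s.endVec.2 : ℤ) : ℝ) * √3⟩ := by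
    rintro c rfl
    rw [circleMap_endAngle]
    simp only [Complex.ext_iff]
    push_cast
    constructor <;> ring
  constructor
  · rintro ⟨c, hc, hp, harc, hw⟩
    rw [circleMap_startAngle_eq_iff] at hp
    rw [key c hp] at hw
    have hend : circleMap c 2 s.endAngle ∈ arc c s := ⟨_, Set.right_mem_uIcc, rfl⟩
    have hpos := (harc hend).2
    rw [key c hp] at hpos
    have hpos' := nonneg_of_mul_nonneg_left hpos h3
    rw [hp, mk_mem_centres_iff] at hc
    exact ⟨hc.1, hc.2, by exact_mod_cast hpos', hw⟩
  · rintro ⟨h2, h4, hpos, hw⟩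
    refine ⟨_, (mk_mem_centres_iff _ _).mpr ⟨h2, h4⟩,
      (circleMap_startAngle_eq_iff _ _ _ _).mpr rfl, fun z hz => ?_, ?_⟩
    · have hl : 0 ≤ y - s.startVec.2 + s.lower := by
        cases s <;> simp only [Step.startVec, Step.endVec, Step.lower] at * <;> omega
      have hl : (0 : ℝ) ≤ ((y - s.startVec.2 + s.lower : ℤ) : ℝ) := by exact_mod_cast hl
      obtain ⟨h1, h2⟩ := arc_bounds hz
      have hx' : (0 : ℝ) ≤ x := by exact_mod_cast hx
      have := mul_nonneg hl h3.le
      push_cast at *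
      constructor <;> linarith
    · rwa [key _ rfl]

lemma exists_next_iff {st : State} {x y : ℤ} (h : IsAt st x y) (s : Step) :
    (∃ st', st.next s = some st') ↔ 2 ∣ y - s.startVec.2 ∧
      4 ∣ (x - s.startVec.1) - (y - s.startVec.2) - 2 ∧ 0 ≤ y - s.startVec.2 + s.endVec.2 := by
  obtain (_ | k) | k | k := st <;> cases s <;>
    simp only [IsAt, State.next, Step.startVec, Step.endVec, Option.some.injEq, exists_eq',
      reduceCtorEq, exists_false, true_iff, false_iff] at h ⊢ <;> omega

lemma IsAt.next {st st' : State} {x y : ℤ} (h : IsAt st x y) {s : Step}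
    (hs : st.next s = some st') :
    IsAt st' (x - s.startVec.1 + s.endVec.1) (y - s.startVec.2 + s.endVec.2) := by
  obtain (_ | k) | k | k := st <;> cases s <;>
    simp only [State.next, Option.some.injEq, reduceCtorEq] at hs <;> subst hs <;>
    simp only [IsAt, Step.startVec, Step.endVec] at h ⊢ <;> omega

/-- From a point in a given state, the words of paths ending on the `x`-axis are the words accepted
from that state. -/
lemma exists_isPath_iff_accepts (w : List Step) : ∀ {st : State} {x y : ℤ}, IsAt st x y →
    ((∃ q : ℂ, IsPath ⟨(x : ℝ), (y : ℝ) * √3⟩ w q ∧ q.im = 0) ↔ Accepts st w) := by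
  induction w with
  | nil =>
    have h3 : √3 ≠ 0 := by positivity
    intro st x y h
    simp only [IsPath, Accepts, exists_eq_left', mul_eq_zero, h3, or_false, Int.cast_eq_zero]
    cases st <;> simp only [IsAt] at h <;> simp <;> omega
  | cons s w ih =>
    intro st x y h
    have hx : 0 ≤ x := by cases st <;> exact h.1
    have hy : 0 ≤ y := by cases st <;> simp only [IsAt] at h <;> omega
    simp only [Accepts]
    constructor
    · rintro ⟨q, hq, hq0⟩
      obtain ⟨h2, h4, hpos, hw⟩ := (isPath_cons_iff hx hy).mp hq
      obtain ⟨st', hst'⟩ := (exists_next_iff h s).mpr ⟨h2, h4, hpos⟩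
      exact ⟨st', hst', (ih (h.next hst')).mp ⟨q, hw, hq0⟩⟩
    · rintro ⟨st', hst', hw⟩
      obtain ⟨h2, h4, hpos⟩ := (exists_next_iff h s).mp ⟨st', hst'⟩
      obtain ⟨q, hq, hq0⟩ := (ih (h.next hst')).mpr hw
      exact ⟨q, (isPath_cons_iff hx hy).mpr ⟨h2, h4, hpos, hq⟩, hq0⟩

lemma isPackingPath_iff_accepts (w : List Step) : IsPackingPath w ↔ Accepts (.A 0) w := by
  have h0 : IsAt (.A 0) 0 0 := by simp [IsAt]
  rw [← exists_isPath_iff_accepts w h0, IsPackingPath]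
  norm_num
  rfl

open PowerSeries Filter Topology

/-! ### Counting accepted words -/

lemma width_cons (s : Step) (w : List Step) : width (s :: w) = s.width + width w := by
  simp [width]

lemma finite_setOf_width_eq (n : ℕ) : {w | width w = n}.Finite := by
  have : Finite Step := by
    refine Set.finite_univ_iff.mp (Set.Finite.subset
      (s := {Step.U, Step.F, Step.D, Step.Ubar, Step.Fbar, Step.Dbar}) (Set.toFinite _) ?_)
    rintro (_ | _) - <;> simp
  refine (List.finite_length_le Step n).subset ?_
  rintro w rfl
  induction w with
  | nil => simp
  | cons s w ih =>
    have h1 : 1 ≤ s.width := by cases s <;> simp [Step.width]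
    simp only [width_cons, Set.mem_ofPred_eq, List.length_cons] at ih ⊢
    omega

/-- The generating function of a set of words with respect to the width. -/
def gf (L : Set (List Step)) : PowerSeries ℚ := mk fun n => ((L ∩ {w | width w = n}).ncard : ℚ)

lemma gf_union {L L' : Set (List Step)} (h : Disjoint L L') : gf (L ∪ L') = gf L + gf L' := by
  ext n
  simp only [gf, coeff_mk, map_add]
  rw [Set.union_inter_distrib_right, Set.ncard_union_eq
    (h.mono Set.inter_subset_left Set.inter_subset_left)
    ((finite_setOf_width_eq n).inter_of_right _) ((finite_setOf_width_eq n).inter_of_right _)]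
  push_cast
  rfl

lemma gf_cons (s : Step) (L : Set (List Step)) :
    gf (List.cons s '' L) = X ^ s.width * gf L := by
  ext n
  rw [coeff_X_pow_mul']
  simp only [gf, coeff_mk]
  split_ifs with h
  · have : List.cons s '' L ∩ {w | width w = n} =
        List.cons s '' (L ∩ {w | width w = n - s.width}) := by
      ext w
      constructor
      · rintro ⟨⟨w, hw, rfl⟩, hn⟩
        refine ⟨w, ⟨hw, ?_⟩, rfl⟩
        simp only [width_cons, Set.mem_ofPred_eq] at hn ⊢
        omega
      · rintro ⟨w, ⟨hw, hn⟩, rfl⟩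
        refine ⟨⟨w, hw, rfl⟩, ?_⟩
        simp only [width_cons, Set.mem_ofPred_eq] at hn ⊢
        omega
    rw [this, Set.ncard_image_of_injective _ (List.cons_injective)]
  · have : List.cons s '' L ∩ {w | width w = n} = ∅ := by
      rw [Set.eq_empty_iff_forall_notMem]
      rintro _ ⟨⟨w, hw, rfl⟩, hn⟩
      simp only [width_cons, Set.mem_ofPred_eq] at hn
      omega
    simp [this]

lemma gf_nil : gf {[]} = 1 := by
  ext n
  simp only [gf, coeff_mk, coeff_one]
  split_ifs with h
  · subst h
    rw [Set.inter_eq_left.mpr (by simp [width])]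
    simp
  · have : ({[]} : Set (List Step)) ∩ {w | width w = n} = ∅ := by
      rw [Set.eq_empty_iff_forall_notMem]
      rintro _ ⟨rfl, hn⟩
      exact h (by simpa [width] using hn.symm)
    simp [this]

lemma disjoint_image_cons {s s' : Step} (h : s ≠ s') (L L' : Set (List Step)) :
    Disjoint (List.cons s '' L) (List.cons s' '' L') := by
  rw [Set.disjoint_left]
  rintro _ ⟨w, -, rfl⟩ ⟨w', -, hw⟩
  exact h (List.cons.inj hw).1.symm

/-- The linear system satisfied by the generating functions of the words accepted from each
state. -/
structure IsSolution (f : State → PowerSeries ℚ) : Prop where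
  A_zero : f (.A 0) = 1 + X * f (.B 0)
  A_succ : ∀ k, f (.A (k + 1)) = X * f (.B (k + 1)) + X * f (.C k)
  B : ∀ k, f (.B k) = X ^ 2 * f (.C k) + X * f (.A (k + 1))
  C : ∀ k, f (.C k) = X * f (.A k) + X ^ 2 * f (.B k)

/-- Every state but the lowest one has exactly two outgoing arcs. -/
lemma setOf_accepts_eq {st st₁ st₂ : State} {s₁ s₂ : Step} (h₁ : st.next s₁ = some st₁)
    (h₂ : st.next s₂ = some st₂) (h : ∀ s, s ≠ s₁ → s ≠ s₂ → st.next s = none) (h0 : st ≠ .A 0) :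
    {w | Accepts st w} =
      List.cons s₁ '' {w | Accepts st₁ w} ∪ List.cons s₂ '' {w | Accepts st₂ w} := by
  ext w
  cases w with
  | nil => simp [Accepts, h0]
  | cons s w =>
    by_cases hs₁ : s = s₁
    · subst hs₁
      by_cases hs₂ : s = s₂
      · subst hs₂
        simp_all [Accepts]
      · simp [Accepts, h₁, Ne.symm hs₂]
    · by_cases hs₂ : s = s₂
      · subst hs₂
        simp [Accepts, h₂, Ne.symm hs₁]
      · simp [Accepts, h s hs₁ hs₂, Ne.symm hs₁, Ne.symm hs₂]

lemma isSolution_gf_accepts : IsSolution fun st => gf {w | Accepts st w} where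
  A_zero := by
    have : {w | Accepts (.A 0) w} = {[]} ∪ List.cons .U '' {w | Accepts (.B 0) w} := by
      ext w
      cases w with
      | nil => simp [Accepts]
      | cons s w => cases s <;> simp [Accepts, State.next]
    rw [this, gf_union (by simp), gf_nil, gf_cons]
    simp [Step.width]
  A_succ k := by
    rw [setOf_accepts_eq (st := .A (k + 1)) (s₁ := .U) (s₂ := .Dbar) rfl rfl
        (by rintro (_ | _) <;> simp [State.next]) (by simp),
      gf_union (disjoint_image_cons (by simp) _ _), gf_cons, gf_cons]
    simp [Step.width]
  B k := by
    rw [setOf_accepts_eq (st := .B k) (s₁ := .F) (s₂ := .Ubar) rfl rfl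
        (by rintro (_ | _) <;> simp [State.next]) (by simp),
      gf_union (disjoint_image_cons (by simp) _ _), gf_cons, gf_cons]
    simp [Step.width]
  C k := by
    rw [setOf_accepts_eq (st := .C k) (s₁ := .D) (s₂ := .Fbar) rfl rfl
        (by rintro (_ | _) <;> simp [State.next]) (by simp),
      gf_union (disjoint_image_cons (by simp) _ _), gf_cons, gf_cons]
    simp [Step.width]

lemma widthGF_eq_gf : widthGF = gf {w | Accepts (.A 0) w} := by
  simp only [widthGF, gf, packingPaths, isPackingPath_iff_accepts]
  rfl

/-- Every term of the system carries a positive power of `X`, so that the coefficients of a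
solution are determined one degree at a time. -/
lemma IsSolution.unique {f g : State → PowerSeries ℚ} (hf : IsSolution f) (hg : IsSolution g) :
    f = g := by
  have key : ∀ n : ℕ, ∀ st, X ^ n ∣ f st - g st := by
    intro n
    induction n with
    | zero => simp
    | succ n ih =>
      have h1 : ∀ st, X ^ (n + 1) ∣ X * (f st - g st) := fun st => by
        rw [pow_succ']
        exact mul_dvd_mul_left _ (ih st)
      have h2 : ∀ st, X ^ (n + 1) ∣ X ^ 2 * (f st - g st) := fun st => by
        rw [pow_two, mul_assoc]
        exact (h1 st).mul_left _
      rintro ((_ | k) | k | k)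
      · rw [hf.A_zero, hg.A_zero, show 1 + X * f (.B 0) - (1 + X * g (.B 0)) =
          X * (f (.B 0) - g (.B 0)) by ring]
        exact h1 _
      · rw [hf.A_succ, hg.A_succ, add_sub_add_comm, ← mul_sub, ← mul_sub]
        exact dvd_add (h1 _) (h1 _)
      · rw [hf.B, hg.B, add_sub_add_comm, ← mul_sub, ← mul_sub]
        exact dvd_add (h2 _) (h1 _)
      · rw [hf.C, hg.C, add_sub_add_comm, ← mul_sub, ← mul_sub]
        exact dvd_add (h1 _) (h2 _)
  funext st
  rw [← sub_eq_zero]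
  ext n
  rw [map_zero]
  exact X_pow_dvd_iff.mp (key (n + 1) st) n n.lt_succ_self

lemma two_ne_zero_powerSeries : (2 : PowerSeries ℚ) ≠ 0 := fun h => by
  have h := congrArg constantCoeff h
  rw [map_ofNat, map_zero] at h
  norm_num at h

/-- The solution is geometric in the height: lowering a path by one row costs a factor `r`. -/
lemma widthGF_eq_of_quadratic {r S : PowerSeries ℚ}
    (hr : X ^ 2 * r ^ 2 = (1 - 3 * X ^ 4) * r - X ^ 2) (hS : 2 * X ^ 2 * S = X ^ 2 + r) :
    widthGF = S := by
  obtain ⟨u, hu⟩ : ∃ u : PowerSeries ℚ, u * (1 - X ^ 4) = 1 :=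
    ⟨(1 - X ^ 4)⁻¹, PowerSeries.inv_mul_cancel _ (by simp)⟩
  have hX : (2 * X ^ 2 : PowerSeries ℚ) ≠ 0 :=
    mul_ne_zero two_ne_zero_powerSeries (pow_ne_zero _ X_ne_zero)
  have hS' : S * (1 - 2 * X ^ 4 - X ^ 2 * r) = 1 - X ^ 4 := by
    refine mul_left_cancel₀ hX ?_
    linear_combination (1 - 2 * X ^ 4 - X ^ 2 * r) * hS - hr
  have hsol : IsSolution fun st => match st with
      | .A k => S * r ^ k
      | .B k => u * S * r ^ k * (X ^ 3 + X * r)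
      | .C k => u * S * r ^ k * (X + X ^ 3 * r) := by
    constructor
    · linear_combination (-S) * hu + u * hS' + hu
    · intro k
      simp only
      linear_combination (-(S * r ^ (k + 1))) * hu - u * S * r ^ k * hr
    · intro k
      simp only
      linear_combination (S * r ^ (k + 1) * X) * hu
    · intro k
      simp only
      linear_combination (S * r ^ k * X) * hu
  rw [widthGF_eq_gf]
  simpa using congrFun (isSolution_gf_accepts.unique hsol) (.A 0)

/-! ### The square root -/

/-- The power series of `√(1 - a z)`, written with the Catalan series `C = 1 + z C²`. -/
def sqrtSeries (a : ℚ) : PowerSeries ℚ :=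
  1 - C (a / 2) * X * rescale (a / 4) (catalanSeries.map (Nat.castRingHom ℚ))

lemma rescale_catalanSeries (b : ℚ) :
    rescale b (catalanSeries.map (Nat.castRingHom ℚ)) =
      1 + C b * X * rescale b (catalanSeries.map (Nat.castRingHom ℚ)) ^ 2 := by
  have h := congrArg (fun f => rescale b (f.map (Nat.castRingHom ℚ))) catalanSeries_sq_mul_X_add_one
  simp only [map_add, map_mul, map_pow, map_one, map_X, rescale_X] at h
  linear_combination -h

lemma sqrtSeries_sq (a : ℚ) : sqrtSeries a ^ 2 = 1 - C a * X := by
  have h := rescale_catalanSeries (a / 4)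
  have h1 : C a = 2 * C (a / 2) := by
    rw [← map_ofNat C 2, ← map_mul]
    congr 1
    ring
  have h2 : C (a / 2) = 2 * C (a / 4) := by
    rw [← map_ofNat C 2, ← map_mul]
    congr 1
    ring
  rw [sqrtSeries, h1, h2]
  linear_combination (-4 * C (a / 4) * X) * h

/-- The power series of `√(1 - 10 z + 9 z²)`, as the product of `√(1 - z)` and `√(1 - 9 z)`. -/
def discrSqrt : PowerSeries ℚ := sqrtSeries 1 * sqrtSeries 9

lemma discrSqrt_sq : discrSqrt ^ 2 = 1 - 10 * X + 9 * X ^ 2 := by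
  rw [discrSqrt, mul_pow, sqrtSeries_sq, sqrtSeries_sq]
  simp only [map_one, map_ofNat]
  ring

/-- The series `N` with `2 z N = 1 - 3 z - √(1 - 10 z + 9 z²)`. Then `x² N(x⁴)` is the factor by
which generating functions change from one row of circles to the next. The coefficients of `N` are
shifted coefficients of the right-hand side, whose linear term `-3 z` gives the correction at
`n = 0`. -/
def descentSeries : PowerSeries ℚ := PowerSeries.mk fun n => -coeff (n + 1) discrSqrt / 2 -
  if n = 0 then 3 / 2 else 0

lemma constantCoeff_discrSqrt : constantCoeff discrSqrt = 1 := by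
  simp [discrSqrt, sqrtSeries]

lemma two_mul_X_mul_descentSeries : 2 * X * descentSeries = 1 - 3 * X - discrSqrt := by
  -- Numerals are written as constant series so that `coeff_C_mul` applies.
  have h2 : (2 : PowerSeries ℚ) = C 2 := (map_ofNat C 2).symm
  have h3 : (3 : PowerSeries ℚ) = C 3 := (map_ofNat C 3).symm
  ext n
  rw [mul_assoc, h2, h3, coeff_C_mul, map_sub, map_sub, coeff_C_mul]
  cases n with
  | zero => simp [constantCoeff_discrSqrt]
  | succ n =>
    simp only [coeff_succ_X_mul, descentSeries, coeff_mk, coeff_one, coeff_X]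
    split_ifs <;> simp_all <;> ring

/-- The generating function of the packing paths by a quarter of their width. -/
def quarterWidthGF : PowerSeries ℚ := C (1 / 2) * (1 + descentSeries)

lemma four_mul_X_mul_quarterWidthGF : 4 * X * quarterWidthGF = 1 - X - discrSqrt := by
  have h4 : C (1 / 2) * (4 : PowerSeries ℚ) = 2 := by
    rw [← map_ofNat C 4, ← map_ofNat C 2, ← map_mul]
    norm_num
  rw [quarterWidthGF]
  linear_combination (X * (1 + descentSeries)) * h4 + two_mul_X_mul_descentSeries

lemma X_mul_descentSeries_sq :
    X * descentSeries ^ 2 = (1 - 3 * X) * descentSeries - 1 := by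
  have hX : (2 * 2 * X : PowerSeries ℚ) ≠ 0 :=
    mul_ne_zero (mul_ne_zero two_ne_zero_powerSeries two_ne_zero_powerSeries) X_ne_zero
  refine mul_left_cancel₀ hX ?_
  -- Multiplication by `4 X` completes the square.
  linear_combination (2 * X * descentSeries - (1 - 3 * X) - discrSqrt) *
    two_mul_X_mul_descentSeries + discrSqrt_sq

lemma two_mul_quarterWidthGF : 2 * quarterWidthGF = 1 + descentSeries := by
  rw [quarterWidthGF, ← mul_assoc, ← map_ofNat C 2, ← map_mul]
  norm_num

/-- Packing paths have widths divisible by `4`. -/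
lemma widthGF_eq_expand : widthGF = expand 4 four_ne_zero quarterWidthGF := by
  have h1 := congrArg (expand 4 four_ne_zero) X_mul_descentSeries_sq
  have h2 := congrArg (expand 4 four_ne_zero) two_mul_quarterWidthGF
  simp only [map_mul, map_pow, map_add, map_sub, map_one, map_ofNat, expand_X] at h1 h2
  apply widthGF_eq_of_quadratic (r := X ^ 2 * expand 4 four_ne_zero descentSeries)
  · linear_combination X ^ 2 * h1
  · linear_combination X ^ 2 * h2

theorem exists_closed_form : ∃ R r : PowerSeries ℚ,
    R ^ 2 = 1 - 10 * X ^ 4 + 9 * X ^ 8 ∧ constantCoeff R = 1 ∧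
    2 * X ^ 2 * r = 1 - 3 * X ^ 4 - R ∧ 2 * X ^ 2 * widthGF = X ^ 2 + r ∧
    4 * X ^ 4 * widthGF = 1 - X ^ 4 - R := by
  have h1 := congrArg (expand 4 four_ne_zero) two_mul_X_mul_descentSeries
  have h2 := congrArg (expand 4 four_ne_zero) two_mul_quarterWidthGF
  have h3 := congrArg (expand 4 four_ne_zero) discrSqrt_sq
  simp only [map_mul, map_pow, map_add, map_sub, map_one, map_ofNat, expand_X] at h1 h2 h3
  refine ⟨expand 4 four_ne_zero discrSqrt, X ^ 2 * expand 4 four_ne_zero descentSeries,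
    ?_, ?_, ?_, ?_, ?_⟩
  · linear_combination h3
  · rw [constantCoeff_expand, constantCoeff_discrSqrt]
  · linear_combination h1
  · rw [widthGF_eq_expand]
    linear_combination X ^ 2 * h2
  · rw [widthGF_eq_expand]
    linear_combination 2 * X ^ 4 * h2 + h1

lemma coeff_four_mul_widthGF (n : ℕ) : coeff (4 * n) widthGF = coeff n quarterWidthGF := by
  rw [widthGF_eq_expand, coeff_expand_mul]

lemma coeff_widthGF_of_not_dvd {m : ℕ} (h : ¬ 4 ∣ m) : coeff m widthGF = 0 := by
  rw [widthGF_eq_expand, coeff_expand_of_not_dvd _ _ _ h]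

/-! ### Coefficients -/

/-- The coefficient of `y ^ n` in `((1 + y) (4 + y)) ^ n`. -/
def diagSum (n : ℕ) : ℚ := ∑ k ∈ Finset.range (n + 1), (4 : ℚ) ^ k * (n.choose k : ℚ) ^ 2

/-- The coefficient of `y ^ (n + 1)` in `((1 + y) (4 + y)) ^ n`. -/
def adjSum (n : ℕ) : ℚ :=
  ∑ k ∈ Finset.range (n + 1), (4 : ℚ) ^ k * (n.choose k : ℚ) * (n.choose (k + 1) : ℚ)

lemma diagSum_eq (n : ℕ) : diagSum n =
    1 + 4 * ∑ k ∈ Finset.range (n + 1), (4 : ℚ) ^ k * (n.choose (k + 1) : ℚ) ^ 2 := by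
  rw [diagSum, Finset.sum_range_succ', Finset.sum_range_succ _ n, Nat.choose_succ_self,
    Nat.cast_zero, zero_pow two_ne_zero, mul_zero, add_zero, Finset.mul_sum, add_comm]
  simp [pow_succ', mul_assoc]

lemma diagSum_succ (n : ℕ) : diagSum (n + 1) = 5 * diagSum n + 8 * adjSum n := by
  have h := diagSum_eq n
  have : diagSum (n + 1) = 1 + 4 * diagSum n + 8 * adjSum n +
      4 * ∑ k ∈ Finset.range (n + 1), (4 : ℚ) ^ k * (n.choose (k + 1) : ℚ) ^ 2 := by
    rw [diagSum, Finset.sum_range_succ', diagSum, adjSum, Finset.mul_sum, Finset.mul_sum,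
      Finset.mul_sum, add_assoc, add_assoc, ← Finset.sum_add_distrib, ← Finset.sum_add_distrib,
      add_comm]
    congr 1
    · simp
    · refine Finset.sum_congr rfl fun k _ => ?_
      rw [Nat.choose_succ_succ]
      push_cast
      ring
  linarith

/-- After splitting `n + 2 = (n + 1 - k) + (k + 1)`, each part is absorbed by one of the two binomial
coefficients of the `k`-th term. -/
lemma adjSum_succ (n : ℕ) :
    ((n : ℚ) + 2) * adjSum (n + 1) = (n + 1) * (5 * adjSum n + 2 * diagSum n) := by
  have hterm : ∀ k ∈ Finset.range (n + 1),
      ((n : ℚ) + 2) * ((4 : ℚ) ^ k * ((n + 1).choose k : ℚ) * ((n + 1).choose (k + 1) : ℚ)) =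
        (n + 1) * ((4 : ℚ) ^ k * (n.choose k : ℚ) ^ 2 +
          (4 : ℚ) ^ k * (n.choose k : ℚ) * (n.choose (k + 1) : ℚ) +
          (4 : ℚ) ^ k * (n.choose k : ℚ) * ((n + 1).choose k : ℚ)) := by
    intro k hk
    have hk : k ≤ n + 1 := by
      have := Finset.mem_range.mp hk
      omega
    have h1 : ((n : ℚ) + 1) * n.choose k = (n + 1).choose (k + 1) * (k + 1) := by
      exact_mod_cast Nat.add_one_mul_choose_eq n k
    have h2 : (n.choose k : ℚ) * (n + 1) = (n + 1).choose k * (n + 1 - k) := by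
      have := Nat.choose_mul_succ_eq n k
      rw [← Nat.cast_inj (R := ℚ)] at this
      rw [Nat.cast_mul, Nat.cast_mul, Nat.cast_sub hk] at this
      exact_mod_cast this
    have h3 : ((n + 1).choose (k + 1) : ℚ) = n.choose k + n.choose (k + 1) := by
      exact_mod_cast Nat.choose_succ_succ n k
    linear_combination (-(4 : ℚ) ^ k * (n + 1).choose k) * h1 -
      (4 : ℚ) ^ k * (n + 1).choose (k + 1) * h2 + (4 : ℚ) ^ k * n.choose k * (n + 1) * h3
  have hlast : ∑ k ∈ Finset.range (n + 1), (4 : ℚ) ^ k * (n.choose k : ℚ) * ((n + 1).choose k : ℚ) =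
      4 * adjSum n + diagSum n := by
    rw [diagSum_eq, adjSum, Finset.sum_range_succ' (n := n), Finset.mul_sum, Finset.mul_sum,
      add_left_comm, ← Finset.sum_add_distrib, Finset.sum_range_succ _ n, Nat.choose_succ_self,
      add_comm]
    congr 1
    · simp
    · rw [Nat.cast_zero, mul_zero, mul_zero, zero_pow two_ne_zero, mul_zero, mul_zero, add_zero,
        add_zero]
      refine Finset.sum_congr rfl fun k _ => ?_
      rw [Nat.choose_succ_succ n k]
      push_cast
      ring
  rw [adjSum, Finset.sum_range_succ, Nat.choose_succ_self, Nat.cast_zero, mul_zero, add_zero,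
    Finset.mul_sum, Finset.sum_congr rfl hterm, ← Finset.mul_sum, Finset.sum_add_distrib,
    Finset.sum_add_distrib, hlast, ← adjSum, ← diagSum]
  ring

/-- Multiplying the `n`-th coefficient by `n` is the operator `X d/dX`. -/
lemma coeff_X_mul_derivative (f : PowerSeries ℚ) (n : ℕ) :
    coeff n (X * d⁄dX ℚ f) = n * coeff n f := by
  cases n with
  | zero => simp
  | succ n =>
    rw [coeff_succ_X_mul, coeff_derivative, mul_comm]
    push_cast
    rfl

lemma discrSqrt_mul_derivative : discrSqrt * d⁄dX ℚ discrSqrt = 9 * X - 5 := by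
  have h := congrArg (d⁄dX ℚ) discrSqrt_sq
  have h9 : (9 : PowerSeries ℚ) = C 9 := (map_ofNat C 9).symm
  have h10 : (10 : PowerSeries ℚ) = C 10 := (map_ofNat C 10).symm
  rw [h9, h10] at h
  simp only [map_add, map_sub, Derivation.leibniz, Derivation.leibniz_pow, derivative_C,
    derivative_X, smul_eq_mul, Derivation.map_one_eq_zero, nsmul_eq_mul] at h
  rw [← h9, ← h10] at h
  refine mul_left_cancel₀ two_ne_zero_powerSeries ?_
  push_cast at h
  linear_combination h

lemma four_mul_derivative_quarterWidthGF :
    4 * quarterWidthGF + 4 * X * d⁄dX ℚ quarterWidthGF = -1 - d⁄dX ℚ discrSqrt := by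
  have h := congrArg (d⁄dX ℚ) four_mul_X_mul_quarterWidthGF
  have h4 : (4 : PowerSeries ℚ) = C 4 := (map_ofNat C 4).symm
  rw [h4] at h
  simp only [map_sub, Derivation.leibniz, derivative_C, derivative_X, smul_eq_mul,
    Derivation.map_one_eq_zero] at h
  rw [← h4] at h
  linear_combination h

lemma discrSqrt_inv_mul : discrSqrt⁻¹ * discrSqrt = 1 :=
  PowerSeries.inv_mul_cancel _ (by simp [constantCoeff_discrSqrt])

lemma discrSqrt_ne_zero : discrSqrt ≠ 0 := fun h => by
  simpa [h] using discrSqrt_inv_mul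

/-- The generating function form of `diagSum_succ`. -/
lemma discrSqrt_inv_eq :
    discrSqrt⁻¹ = 1 + X * (5 * discrSqrt⁻¹ + 4 * (X * d⁄dX ℚ quarterWidthGF)) := by
  refine mul_right_cancel₀ discrSqrt_ne_zero ?_
  linear_combination (1 - 5 * X) * discrSqrt_inv_mul - discrSqrt_sq
    - discrSqrt * X * four_mul_derivative_quarterWidthGF
    + discrSqrt * four_mul_X_mul_quarterWidthGF + X * discrSqrt_mul_derivative

/-- The generating function form of `adjSum_succ`. -/
lemma quarterWidthGF_eq : X * d⁄dX ℚ quarterWidthGF + quarterWidthGF =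
    1 + X * (5 * (X * d⁄dX ℚ quarterWidthGF) + 4 * discrSqrt⁻¹) := by
  have h4 : (2 * 2 * discrSqrt : PowerSeries ℚ) ≠ 0 :=
    mul_ne_zero (mul_ne_zero two_ne_zero_powerSeries two_ne_zero_powerSeries) discrSqrt_ne_zero
  refine mul_left_cancel₀ h4 ?_
  linear_combination (-16 * X) * discrSqrt_inv_mul - 5 * discrSqrt_sq
    + discrSqrt * (1 - 5 * X) * four_mul_derivative_quarterWidthGF
    + 5 * discrSqrt * four_mul_X_mul_quarterWidthGF - (1 - 5 * X) * discrSqrt_mul_derivative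

/-- The coefficients of `1 / R` and of `X S'` satisfy the same first order linear system
as `diagSum` and `2 adjSum`. -/
lemma coeff_quarterWidthGF_and_inv (n : ℕ) :
    n * coeff n quarterWidthGF = 2 * adjSum n ∧ coeff n discrSqrt⁻¹ = diagSum n := by
  induction n with
  | zero => simp [adjSum, diagSum, constantCoeff_discrSqrt]
  | succ n ih =>
    obtain ⟨h1, h2⟩ := ih
    have h4 : (4 : PowerSeries ℚ) = C 4 := (map_ofNat C 4).symm
    have h5 : (5 : PowerSeries ℚ) = C 5 := (map_ofNat C 5).symm
    have hd := congrArg (coeff (n + 1)) discrSqrt_inv_eq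
    have hs := congrArg (coeff (n + 1)) quarterWidthGF_eq
    rw [map_add, coeff_one, if_neg n.succ_ne_zero, zero_add, coeff_succ_X_mul, map_add, h4, h5,
      coeff_C_mul, coeff_C_mul, coeff_X_mul_derivative, h1, h2] at hd
    rw [map_add, map_add, coeff_X_mul_derivative, coeff_one, if_neg n.succ_ne_zero, zero_add,
      coeff_succ_X_mul, map_add, h4, h5, coeff_C_mul, coeff_C_mul, coeff_X_mul_derivative,
      h1, h2] at hs
    constructor
    · have hn : (n : ℚ) + 2 ≠ 0 := by positivity
      refine mul_left_cancel₀ hn ?_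
      push_cast at hs ⊢
      linear_combination (n + 1 : ℚ) * hs - 2 * adjSum_succ n
    · rw [hd, diagSum_succ]
      ring

lemma coeff_quarterWidthGF {n : ℕ} (hn : 1 ≤ n) :
    coeff n quarterWidthGF = 2 / (n : ℚ) * adjSum n := by
  have : (n : ℚ) ≠ 0 := by positivity
  field_simp
  linear_combination (coeff_quarterWidthGF_and_inv n).1

lemma coeff_zero_quarterWidthGF : coeff 0 quarterWidthGF = 1 := by
  have := congrArg (coeff 0) quarterWidthGF_eq
  simpa using this

/-! ### Asymptotics -/

/-- Wallis' product as a statement on central binomial coefficients. -/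
lemma wallis_mul_centralBinom_sq (n : ℕ) :
    Real.Wallis.W n * ((2 * n + 1) * ((n.centralBinom : ℝ) / 4 ^ n) ^ 2) = 1 := by
  have h : (n.centralBinom : ℝ) * (n.factorial * n.factorial) = (2 * n).factorial := by
    have := Nat.choose_mul_factorial_mul_factorial (show n ≤ 2 * n by omega)
    rw [show 2 * n - n = n by omega, ← Nat.centralBinom_eq_two_mul_choose, mul_assoc] at this
    exact_mod_cast this
  have h0 : (n.factorial : ℝ) ≠ 0 := by positivity
  have hc : (n.centralBinom : ℝ) ≠ 0 := by exact_mod_cast n.centralBinom_ne_zero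
  rw [Real.Wallis.W_eq_factorial_ratio, ← h, show (2 : ℝ) ^ (4 * n) = (4 ^ n) ^ 2 by
    rw [← pow_mul, mul_comm n 2, pow_mul, pow_mul]; norm_num [← pow_mul, mul_comm]]
  field_simp

/-- The Catalan numbers, rescaled by their exponential growth. -/
def scaledCatalan (n : ℕ) : ℝ := catalan n / 4 ^ n

/-- The polynomial factor `(2n + 1) ^ (3/2)` of the asymptotics. -/
def growth (n : ℕ) : ℝ := (1 + 2 * (n : ℝ)) ^ (3 / 2 : ℝ)

lemma growth_pos (n : ℕ) : 0 < growth n := by unfold growth; positivity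

lemma growth_eq (n : ℕ) : growth n = (1 + 2 * (n : ℝ)) * √(1 + 2 * (n : ℝ)) := by
  rw [growth, show (3 / 2 : ℝ) = 1 + 1 / 2 by norm_num, Real.rpow_add (by positivity),
    Real.rpow_one, Real.sqrt_eq_rpow]

lemma growth_le_sq (n : ℕ) : growth n ≤ (1 + 2 * (n : ℝ)) ^ 2 := by
  rw [growth_eq, pow_two]
  gcongr
  rw [Real.sqrt_le_left (by positivity)]
  nlinarith [(n.cast_nonneg : (0 : ℝ) ≤ n)]

/-- Submultiplicativity, which bounds the ratio `growth n / growth (n - i)` uniformly in `n`. -/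
lemma growth_le_mul {i n : ℕ} (h : i ≤ n) : growth n ≤ growth (n - i) * growth i := by
  unfold growth
  rw [← Real.mul_rpow (by positivity) (by positivity)]
  apply Real.rpow_le_rpow (by positivity) _ (by norm_num)
  obtain ⟨j, rfl⟩ := Nat.exists_eq_add_of_le h
  rw [Nat.add_sub_cancel_left]
  push_cast
  nlinarith [mul_nonneg (i.cast_nonneg : (0 : ℝ) ≤ i) (j.cast_nonneg : (0 : ℝ) ≤ j)]

lemma scaledCatalan_nonneg (n : ℕ) : 0 ≤ scaledCatalan n := by unfold scaledCatalan; positivity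

lemma scaledCatalan_eq (n : ℕ) :
    scaledCatalan n = (n.centralBinom : ℝ) / 4 ^ n / (n + 1) := by
  have h : ((n : ℝ) + 1) * catalan n = n.centralBinom := by
    exact_mod_cast succ_mul_catalan_eq_centralBinom n
  rw [scaledCatalan, ← h]
  field_simp

lemma scaledCatalan_le_one (n : ℕ) : scaledCatalan n ≤ 1 := by
  have h1 : (n.centralBinom : ℝ) ≤ 4 ^ n := by
    have := Nat.choose_le_two_pow (2 * n) n
    rw [← Nat.centralBinom_eq_two_mul_choose, pow_mul] at this
    exact_mod_cast this
  rw [scaledCatalan_eq, div_div, div_le_one (by positivity)]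
  nlinarith [(n.cast_nonneg : (0 : ℝ) ≤ n), show (0 : ℝ) < 4 ^ n by positivity]

lemma tendsto_scaledCatalan_mul_growth :
    Tendsto (fun n => scaledCatalan n * growth n) atTop (𝓝 (2 * √(2 / Real.pi))) := by
  have hW := Real.Wallis.tendsto_W_nhds_pi_div_two
  have h1 : Tendsto (fun n => √(Real.Wallis.W n)⁻¹) atTop (𝓝 √(2 / Real.pi)) := by
    rw [← inv_div]
    exact (Real.continuous_sqrt.tendsto _).comp (hW.inv₀ (by positivity))
  have h2 : Tendsto (fun n : ℕ => 2 - 1 / ((n : ℝ) + 1)) atTop (𝓝 2) := by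
    simpa using (tendsto_const_nhds (x := (2 : ℝ))).sub tendsto_one_div_add_atTop_nhds_zero_nat
  refine (h2.mul h1).congr fun n => ?_
  have hn : √(Real.Wallis.W n)⁻¹ = √(1 + 2 * (n : ℝ)) * ((n.centralBinom : ℝ) / 4 ^ n) := by
    rw [Real.sqrt_eq_iff_mul_self_eq (by have := Real.Wallis.W_pos n; positivity) (by positivity)]
    refine inv_eq_of_mul_eq_one_right ?_
    linear_combination wallis_mul_centralBinom_sq n +
      (Real.Wallis.W n * ((n.centralBinom : ℝ) / 4 ^ n) ^ 2) *
      Real.mul_self_sqrt (show 0 ≤ 1 + 2 * (n : ℝ) by positivity)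
  rw [hn, scaledCatalan_eq, growth_eq]
  field_simp
  ring

/-- The coefficients of `√(1 - z)`, as real numbers. -/
def sqrtCoeff (i : ℕ) : ℝ := ((coeff i (sqrtSeries 1) : ℚ) : ℝ)

lemma sqrtCoeff_zero : sqrtCoeff 0 = 1 := by simp [sqrtCoeff, sqrtSeries]

lemma sqrtCoeff_succ (i : ℕ) : sqrtCoeff (i + 1) = -(scaledCatalan i / 2) := by
  rw [sqrtCoeff, sqrtSeries, map_sub, mul_assoc, coeff_C_mul, coeff_succ_X_mul, coeff_rescale]
  simp [coeff_one, scaledCatalan]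
  ring

lemma abs_sqrtCoeff_le_one (i : ℕ) : |sqrtCoeff i| ≤ 1 := by
  cases i with
  | zero => simp [sqrtCoeff_zero]
  | succ i =>
    have h0 := scaledCatalan_nonneg i
    have h1 := scaledCatalan_le_one i
    rw [sqrtCoeff_succ, abs_le]
    constructor <;> linarith

lemma summable_norm_sqrtCoeff : Summable fun i => ‖sqrtCoeff i * (1 / 9) ^ i‖ := by
  refine Summable.of_nonneg_of_le (fun _ => norm_nonneg _) (fun i => ?_)
    (summable_geometric_of_lt_one (r := (1 / 9 : ℝ)) (by norm_num) (by norm_num))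
  rw [norm_mul, Real.norm_eq_abs, Real.norm_eq_abs, abs_of_nonneg (a := (1 / 9 : ℝ) ^ i)
    (by positivity)]
  exact mul_le_of_le_one_left (by positivity) (abs_sqrtCoeff_le_one i)

lemma sum_sqrtCoeff_mul_sqrtCoeff (n : ℕ) :
    ∑ ij ∈ Finset.HasAntidiagonal.antidiagonal n, sqrtCoeff ij.1 * sqrtCoeff ij.2 =
      if n = 0 then 1 else if n = 1 then -1 else 0 := by
  have h := congrArg (fun q : ℚ => (q : ℝ)) (congrArg (coeff n) (sqrtSeries_sq 1))
  simp only [pow_two, coeff_mul, map_sub, map_one, one_mul, coeff_one, coeff_X] at h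
  push_cast at h
  simp only [sqrtCoeff]
  rw [h]
  split_ifs <;> simp_all

/-- The value at `1/9` of the series of `√(1 - z)`. -/
lemma tsum_sqrtCoeff : ∑' i, sqrtCoeff i * (1 / 9) ^ i = √(8 / 9) := by
  have hs := summable_norm_sqrtCoeff
  symm
  rw [Real.sqrt_eq_iff_mul_self_eq (by norm_num)]
  · rw [tsum_mul_tsum_eq_tsum_sum_antidiagonal_of_summable_norm hs hs]
    have : ∀ n, ∑ ij ∈ Finset.HasAntidiagonal.antidiagonal n,
        sqrtCoeff ij.1 * (1 / 9) ^ ij.1 * (sqrtCoeff ij.2 * (1 / 9) ^ ij.2) =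
        (if n = 0 then 1 else if n = 1 then -1 else 0) * (1 / 9 : ℝ) ^ n := by
      intro n
      rw [← sum_sqrtCoeff_mul_sqrtCoeff, Finset.sum_mul]
      refine Finset.sum_congr rfl fun ij hij => ?_
      rw [← Finset.HasAntidiagonal.mem_antidiagonal.mp hij, pow_add]
      ring
    simp_rw [this]
    rw [tsum_eq_sum (s := Finset.range 2)]
    · norm_num [Finset.sum_range_succ]
    · intro n hn
      have hn : 1 < n := by simpa using hn
      rw [if_neg (by omega), if_neg (by omega), zero_mul]
  -- The sum is nonnegative: its constant term `1` outweighs the others, which add up to at least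
  -- `-1/8`.
  · rw [hs.of_norm.tsum_eq_zero_add, sqrtCoeff_zero]
    have hg := summable_geometric_of_lt_one (r := (1 / 9 : ℝ)) (by norm_num) (by norm_num)
    have hg' := (hg.mul_left (1 / 9 : ℝ))
    have hle : ∑' i, -(1 / 9 * (1 / 9 : ℝ) ^ i) ≤ ∑' i, sqrtCoeff (i + 1) * (1 / 9) ^ (i + 1) := by
      refine hg'.neg.tsum_le_tsum (fun i => ?_) ((summable_nat_add_iff 1).mpr hs.of_norm)
      have := (abs_le.mp (abs_sqrtCoeff_le_one (i + 1))).1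
      rw [pow_succ', ← neg_one_mul]
      gcongr
    rw [tsum_neg, tsum_mul_left, tsum_geometric_of_lt_one (by norm_num) (by norm_num)] at hle
    norm_num at hle ⊢
    linarith

/-- The coefficients as a convolution, divided by their exponential growth. -/
lemma coeff_quarterWidthGF_eq_sum {n : ℕ} (hn : n ≠ 0) :
    4 * (((coeff n quarterWidthGF : ℚ) : ℝ) / 9 ^ n) = -(sqrtCoeff (n + 1) * (1 / 9) ^ n) +
      9 / 2 * ∑ i ∈ Finset.range (n + 1),
        sqrtCoeff i * (1 / 9) ^ i * scaledCatalan (n - i) := by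
  have h4 : (4 : PowerSeries ℚ) = C 4 := (map_ofNat C 4).symm
  have h : X * (4 * quarterWidthGF) = 1 - X - sqrtSeries 1 + X * (C (9 / 2) *
      (sqrtSeries 1 * rescale (9 / 4) (catalanSeries.map (Nat.castRingHom ℚ)))) := by
    have h := four_mul_X_mul_quarterWidthGF
    rw [discrSqrt, sqrtSeries.eq_def 9] at h
    linear_combination h
  replace h := congrArg (coeff (n + 1)) h
  rw [map_add, coeff_succ_X_mul, coeff_succ_X_mul, map_sub, map_sub, coeff_one, coeff_X,
    if_neg n.succ_ne_zero, if_neg (by omega), h4, coeff_C_mul, coeff_C_mul, coeff_mul,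
    Finset.Nat.sum_antidiagonal_eq_sum_range_succ_mk] at h
  replace h := congrArg (fun q : ℚ => (q : ℝ)) h
  push_cast at h
  have hsum : (∑ i ∈ Finset.range (n + 1), sqrtCoeff i * (1 / 9) ^ i * scaledCatalan (n - i)) =
      (∑ i ∈ Finset.range (n + 1), ((coeff i (sqrtSeries 1) : ℚ) : ℝ) *
        ((coeff (n - i) (rescale (9 / 4) (catalanSeries.map (Nat.castRingHom ℚ))) : ℚ) : ℝ)) /
        9 ^ n := by
    rw [Finset.sum_div]
    refine Finset.sum_congr rfl fun i hi => ?_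
    obtain ⟨j, rfl⟩ := Nat.exists_eq_add_of_le (Nat.lt_succ_iff.mp (Finset.mem_range.mp hi))
    rw [Nat.add_sub_cancel_left, coeff_rescale, scaledCatalan, sqrtCoeff]
    simp [pow_add, div_pow]
    field_simp
  rw [hsum, sqrtCoeff, one_div, inv_pow]
  field_simp
  linear_combination 2 * h

lemma summable_growth : Summable fun i => (1 / 9 : ℝ) ^ i * growth i := by
  have h : Summable fun i : ℕ => (1 / 9 : ℝ) ^ i * (1 + 2 * (i : ℝ)) ^ 2 := by
    have h0 := summable_pow_mul_geometric_of_norm_lt_one 0 (r := (1 / 9 : ℝ)) (by norm_num)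
    have h1 := summable_pow_mul_geometric_of_norm_lt_one 1 (r := (1 / 9 : ℝ)) (by norm_num)
    have h2 := summable_pow_mul_geometric_of_norm_lt_one 2 (r := (1 / 9 : ℝ)) (by norm_num)
    refine ((h0.add (h1.mul_left 4)).add (h2.mul_left 4)).congr fun i => ?_
    ring
  refine h.of_nonneg_of_le (fun i => ?_) (fun i => ?_)
  · have := growth_pos i
    positivity
  · gcongr
    exact growth_le_sq i

lemma growth_add_div_tendsto (i : ℕ) :
    Tendsto (fun n => growth (n + i) / growth n) atTop (𝓝 1) := by
  have h : Tendsto (fun n : ℕ => 1 + 2 * (i : ℝ) / (1 + 2 * (n : ℝ))) atTop (𝓝 (1 + 0)) := by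
    refine tendsto_const_nhds.add (Tendsto.div_atTop tendsto_const_nhds ?_)
    exact tendsto_atTop_add_const_left _ _ (tendsto_natCast_atTop_atTop.const_mul_atTop two_pos)
  have h' := h.rpow_const (p := 3 / 2) (Or.inl (by norm_num))
  rw [add_zero, Real.one_rpow] at h'
  refine h'.congr fun n => ?_
  rw [growth, growth, ← Real.div_rpow (by positivity) (by positivity)]
  congr 1
  push_cast
  field_simp
  ring

/-- By dominated convergence, the slowly decaying factor `scaledCatalan (n - i)` may be replaced
by `scaledCatalan n` in the convolution. -/
lemma tendsto_convolution : Tendsto (fun n => (∑ i ∈ Finset.range (n + 1),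
    sqrtCoeff i * (1 / 9) ^ i * scaledCatalan (n - i)) * growth n) atTop
    (𝓝 (√(8 / 9) * (2 * √(2 / Real.pi)))) := by
  have hlim := tendsto_scaledCatalan_mul_growth
  obtain ⟨K, hK⟩ := hlim.bddAbove_range
  have hK : ∀ n, scaledCatalan n * growth n ≤ K := fun n => hK ⟨n, rfl⟩
  rw [← tsum_sqrtCoeff, ← tsum_mul_right]
  have hsum : ∀ n, (∑ i ∈ Finset.range (n + 1),
      sqrtCoeff i * (1 / 9) ^ i * scaledCatalan (n - i)) * growth n =
      ∑' i, if i ≤ n then sqrtCoeff i * (1 / 9) ^ i * (scaledCatalan (n - i) * growth n) else 0 := by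
    intro n
    rw [tsum_eq_sum (s := Finset.range (n + 1)), Finset.sum_mul]
    · refine Finset.sum_congr rfl fun i hi => ?_
      rw [if_pos (Nat.lt_succ_iff.mp (Finset.mem_range.mp hi)), mul_assoc]
    · intro i hi
      rw [if_neg fun h => hi (Finset.mem_range.mpr (Nat.lt_succ_of_le h))]
  simp_rw [hsum]
  refine tendsto_tsum_of_dominated_convergence (summable_growth.mul_left K) (fun i => ?_)
    (Eventually.of_forall fun n i => ?_)
  · rw [← tendsto_add_atTop_iff_nat i]
    have h := (hlim.mul (growth_add_div_tendsto i)).const_mul (sqrtCoeff i * (1 / 9) ^ i)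
    rw [mul_one] at h
    refine h.congr fun n => ?_
    have := (growth_pos n).ne'
    rw [if_pos (Nat.le_add_left i n), Nat.add_sub_cancel]
    field_simp
  · have hg := growth_pos i
    have hK0 : 0 ≤ K := (mul_nonneg (scaledCatalan_nonneg 0) (growth_pos 0).le).trans (hK 0)
    split_ifs with h
    · have h1 := scaledCatalan_nonneg (n - i)
      have h2 := growth_pos n
      rw [norm_mul, norm_mul, Real.norm_eq_abs, Real.norm_of_nonneg (by positivity),
        Real.norm_of_nonneg (by positivity)]
      calc |sqrtCoeff i| * (1 / 9) ^ i * (scaledCatalan (n - i) * growth n)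
          ≤ 1 * (1 / 9) ^ i * (scaledCatalan (n - i) * (growth (n - i) * growth i)) := by
            gcongr
            · exact abs_sqrtCoeff_le_one i
            · exact growth_le_mul h
        _ = (1 / 9) ^ i * growth i * (scaledCatalan (n - i) * growth (n - i)) := by ring
        _ ≤ (1 / 9) ^ i * growth i * K := by gcongr; exact hK _
        _ = K * ((1 / 9) ^ i * growth i) := by ring
    · rw [norm_zero]
      positivity

lemma tendsto_coeff_quarterWidthGF :
    Tendsto (fun n => ((coeff n quarterWidthGF : ℚ) : ℝ) / 9 ^ n * growth n) atTop
      (𝓝 (3 / √Real.pi)) := by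
  have h1 : Tendsto (fun n => -(sqrtCoeff (n + 1) * (1 / 9) ^ n) * growth n) atTop (𝓝 0) := by
    refine squeeze_zero_norm (fun n => ?_) summable_growth.tendsto_atTop_zero
    have := growth_pos n
    rw [norm_mul, norm_neg, norm_mul, Real.norm_eq_abs, Real.norm_of_nonneg (by positivity),
      Real.norm_of_nonneg this.le]
    gcongr
    exact mul_le_of_le_one_left (by positivity) (abs_sqrtCoeff_le_one _)
  have h := (h1.add (tendsto_convolution.const_mul (9 / 2))).const_mul (1 / 4)
  have hval : 1 / 4 * (0 + 9 / 2 * (√(8 / 9) * (2 * √(2 / Real.pi)))) = 3 / √Real.pi := by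
    rw [Real.sqrt_div (by norm_num) Real.pi, mul_div_assoc', mul_div_assoc', mul_left_comm,
      ← Real.sqrt_mul (by norm_num), show (8 / 9 * 2 : ℝ) = (4 / 3) ^ 2 by norm_num,
      Real.sqrt_sq (by norm_num)]
    ring
  rw [hval] at h
  refine h.congr' ?_
  filter_upwards [eventually_ne_atTop 0] with n hn
  linear_combination (-(growth n) / 4) * coeff_quarterWidthGF_eq_sum hn

end HexPacking

end

theorem mainTheorem3 :
    -- closed form: `R` is the square root with constant term 1, and `r = (1 - 3x⁴ - R) / (2x²)`
    (∃ R r : PowerSeries ℚ,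
      R ^ 2 = 1 - 10 * PowerSeries.X ^ 4 + 9 * PowerSeries.X ^ 8 ∧ PowerSeries.constantCoeff R = 1 ∧
      2 * PowerSeries.X ^ 2 * r = 1 - 3 * PowerSeries.X ^ 4 - R ∧
      2 * PowerSeries.X ^ 2 * HexPacking.widthGF = PowerSeries.X ^ 2 + r ∧
      4 * PowerSeries.X ^ 4 * HexPacking.widthGF = 1 - PowerSeries.X ^ 4 - R) ∧
    -- coefficients
    PowerSeries.coeff 0 HexPacking.widthGF = 1 ∧
    (∀ n : ℕ, 1 ≤ n → PowerSeries.coeff (4 * n) HexPacking.widthGF =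
      2 / (n : ℚ) * ∑ k ∈ Finset.range (n + 1),
        (4 : ℚ) ^ k * (n.choose k : ℚ) * (n.choose (k + 1) : ℚ)) ∧
    (∀ m : ℕ, ¬ 4 ∣ m → PowerSeries.coeff m HexPacking.widthGF = 0) ∧
    -- asymptotics
    Asymptotics.IsEquivalent Filter.atTop
      (fun n : ℕ => ((PowerSeries.coeff (4 * n) HexPacking.widthGF : ℚ) : ℝ))
      (fun n : ℕ => (3 : ℝ) ^ (1 + 2 * n) / (√Real.pi * (1 + 2 * (n : ℝ)) ^ (3 / 2 : ℝ))) := by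

  refine ⟨HexPacking.exists_closed_form, ?_, fun n hn => ?_,
    fun m hm => HexPacking.coeff_widthGF_of_not_dvd hm, ?_⟩
  · rw [← mul_zero 4, HexPacking.coeff_four_mul_widthGF, HexPacking.coeff_zero_quarterWidthGF]
  · rw [HexPacking.coeff_four_mul_widthGF, HexPacking.coeff_quarterWidthGF hn, HexPacking.adjSum]
  · simp_rw [HexPacking.coeff_four_mul_widthGF]
    refine Asymptotics.isEquivalent_of_tendsto_one ?_
    have hpi : √Real.pi ≠ 0 := by positivity
    have h := HexPacking.tendsto_coeff_quarterWidthGF.mul_const (√Real.pi / 3)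
    rw [div_mul_div_comm, mul_comm (3 : ℝ), div_self (by positivity)] at h
    refine h.congr fun n => ?_
    have hg := (HexPacking.growth_pos n).ne'
    rw [Pi.div_apply, ← HexPacking.growth, pow_add, pow_mul]
    field_simp
    norm_num
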